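/- Consider a population split into two groups $b\in\{0,1\}$ of equal size; the true state of the world is $\Phi=0$, and members of group $b$ assign prior probability $y>\tfrac12$ to $\Phi=b$. Let $\nu,k,\delta>0$ be the communication rate, the number of meetings and the death rate, with $\lambda k>1$ for $\lambda=\nu/\delta$; let $\beta\in[0,1)$ be the share of meetings within one's own group and $c>0$ the marginal cost of verification. Effort $\alpha\ge 0$ verifies a message with probability $x(\alpha)$, where $x:[0,\infty)\to[0,\bar x]\subseteq[0,1]$ is continuous, $x(0)=0$, $\bar x=\lim_{\alpha\to\infty}x(\alpha)$, and $x$ is strictly increasing and strictly concave as long as $x(\alpha)<\bar x$. Given verification rates $\ell$ (of messages in line with one's bias) and $h$ (of messages against it), the prevalences $\rho^0_0,\rho^1_0,\rho^1_1\ge 0$ of opinion $m$ in group $b$ (written $\rho^b_m$, with $\rho^0_1=0$, $\rho^0_0\le 1$, $\rho^1_0+\rho^1_1\le 1$) evolve by \begin{align*} \dot\rho^0_0&=\tfrac12(1-\rho^0_0)\nu k[\beta\rho^0_0+(1-\beta)(\rho^1_0+\rho^1_1)]-\tfrac12\delta\rho^0_0,\\ \dot\rho^1_0&=\tfrac12(1-\rho^1_0-\rho^1_1)\nu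 k[\beta(h\rho^1_0+\ell\rho^1_1)+(1-\beta)h\rho^0_0]-\tfrac12\delta\rho^1_0,\\ \dot\rho^1_1&=\tfrac12(1-\rho^1_0-\rho^1_1)\nu k[\beta((1-h)\rho^1_0+(1-\ell)\rho^1_1)+(1-\beta)(1-h)\rho^0_0]-\tfrac12\delta\rho^1_1. \end{align*} An equilibrium (with endogenous verification) consists of efforts $\alpha^b,\alpha^{-b}\ge 0$, a steady state of these equations with rates $\ell=x(\alpha^b)$, $h=x(\alpha^{-b})$ and positive overall prevalence of information $\tfrac12(\rho^0_0+\rho^1_0+\rho^1_1)>0$, and beliefs given by Bayes' rule, \begin{align*} \Pr(b=\Phi\mid m=b)&=\frac{y(\beta\rho^0_0+(1-\beta)\rho^1_0)}{y(\beta\rho^0_0+(1-\beta)\rho^1_0)+(1-y)\beta\rho^1_1},\\ \Pr(b=\Phi\mid m\ne b)&=\frac{y(1-\beta)\rho^1_1}{y(1-\beta)\rho^1_1+(1-y)((1-\beta)\rho^0_0+\beta\rho^1_0)} \end{align*} (any value in $[0,1]$ if the denominator vanishes), such that $\alpha^b$ and $\alpha^{-b}$ maximize $x(\alpha)+(1-x(\alpha))P-c\alpha$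 over $\alpha\ge 0$ for $P=\Pr(b=\Phi\mid m=b)$ and $P=\Pr(b=\Phi\mid m\ne b)$ respectively. Then there is a threshold $\bar y\in(\tfrac12,1)$, depending only on $x$, $c$ and $\beta$, such that for every $y\in[\bar y,1]$ and all $\nu,k,\delta>0$ with $\lambda k>1$ an equilibrium exists in which, for either message, holding an opinion in line with one's bias after unsuccessful verification is optimal, i.e. $\Pr(b=\Phi\mid m)\ge\tfrac12$. If moreover $x(\alpha)<1$ for all $\alpha$, then for every such $y$ this is optimal in every equilibrium, after a message $m\neq b$ and, if $\beta>0$, also after a message $m=b$. -/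

import Mathlib

open Set Filter Topology

namespace RumorModel

/-- `x` is a verification function with limit `xbar`: effort `α ≥ 0` verifies a message with
probability `x α`. It is continuous, vanishes at `0`, takes values in `[0, xbar] ⊆ [0, 1]`, tends to
`xbar`, and is strictly increasing and strictly concave as long as `xbar` has not been reached.
(It may reach `xbar` at a finite effort, after which it is constant, or only asymptotically.) -/
structure IsVerificationFunction (x : ℝ → ℝ) (xbar : ℝ) : Prop where
  continuousOn : ContinuousOn x (Ici 0)
  map_zero : x 0 = 0
  mem_Icc : ∀ α, 0 ≤ α → x α ∈ Icc 0 xbar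
  xbar_le_one : xbar ≤ 1
  tendsto_xbar : Tendsto x atTop (𝓝 xbar)
  strictMonoOn : StrictMonoOn x {α | 0 ≤ α ∧ x α < xbar}
  strictConcaveOn : StrictConcaveOn ℝ {α | 0 ≤ α ∧ x α < xbar} x

/-- Prevalence of opinions. `g0o0`: the proportion of group `0` (biased towards the true state `0`)
holding opinion `0`; `g1o0`, `g1o1`: the proportions of group `1` holding opinion `0` and `1`.
Nobody in group `0` ever holds opinion `1`. -/
structure Prevalence where
  g0o0 : ℝ
  g1o0 : ℝ
  g1o1 : ℝ

/-- Law of motion of opinion `0` in group `0`: its time derivative. -/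
noncomputable def motion_g0o0 (ν k δ β : ℝ) (ρ : Prevalence) : ℝ :=
  1 / 2 * (1 - ρ.g0o0) * (ν * k) * (β * ρ.g0o0 + (1 - β) * (ρ.g1o0 + ρ.g1o1))
    - 1 / 2 * ρ.g0o0 * δ

/-- Law of motion of opinion `0` in group `1`; `l` and `h` are the verification rates of messages
in line with one's bias and against it. -/
noncomputable def motion_g1o0 (ν k δ β l h : ℝ) (ρ : Prevalence) : ℝ :=
  1 / 2 * (1 - ρ.g1o0 - ρ.g1o1) * (ν * k) *
      (β * (h * ρ.g1o0 + l * ρ.g1o1) + (1 - β) * h * ρ.g0o0)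
    - 1 / 2 * ρ.g1o0 * δ

/-- Law of motion of opinion `1` in group `1`. -/
noncomputable def motion_g1o1 (ν k δ β l h : ℝ) (ρ : Prevalence) : ℝ :=
  1 / 2 * (1 - ρ.g1o0 - ρ.g1o1) * (ν * k) *
      (β * ((1 - h) * ρ.g1o0 + (1 - l) * ρ.g1o1) + (1 - β) * (1 - h) * ρ.g0o0)
    - 1 / 2 * ρ.g1o1 * δ

/-- `ρ` is a positive steady state for the verification rates `l` and `h`: its entries are
proportions, all three laws of motion vanish, and overall information prevalence is positive. -/
structure IsPositiveSteadyState (ν k δ β l h : ℝ) (ρ : Prevalence) : Prop where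
  g0o0_nonneg : 0 ≤ ρ.g0o0
  g1o0_nonneg : 0 ≤ ρ.g1o0
  g1o1_nonneg : 0 ≤ ρ.g1o1
  g0_le_one : ρ.g0o0 ≤ 1
  g1_le_one : ρ.g1o0 + ρ.g1o1 ≤ 1
  steady_g0o0 : motion_g0o0 ν k δ β ρ = 0
  steady_g1o0 : motion_g1o0 ν k δ β l h ρ = 0
  steady_g1o1 : motion_g1o1 ν k δ β l h ρ = 0
  positive : 0 < (ρ.g0o0 + (ρ.g1o0 + ρ.g1o1)) / 2

/-- `p` is a posterior probability of an event of prior probability `y`, after an observation of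
likelihood `a` under the event and `a'` under its complement: Bayes' rule
`p = y * a / (y * a + (1 - y) * a')`, which leaves `p ∈ [0, 1]` free if the observation
has probability zero. -/
def IsPosterior (y a a' p : ℝ) : Prop :=
  p ∈ Icc (0 : ℝ) 1 ∧ p * (y * a + (1 - y) * a') = y * a

/-- Expected utility of effort `α` for an individual who believes with probability `p`, after hearing
the message, that their bias is correct, and who holds an opinion in line with their bias if
verification is unsuccessful. -/
def utility (x : ℝ → ℝ) (c p α : ℝ) : ℝ :=
  x α + (1 - x α) * p - c * α

/-- Efforts in verifying a message in line with and against one's bias, the prevalence of opinions,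
and the beliefs that one's bias is correct after hearing either message. -/
structure Profile where
  effortInLine : ℝ
  effortAgainst : ℝ
  prevalence : Prevalence
  beliefInLine : ℝ
  beliefAgainst : ℝ

/-- `E` is an equilibrium with endogenous verification: the prevalences are a positive steady state
for the verification rates induced by the efforts, beliefs follow from the prior `y` and
these prevalences by Bayes' rule, and the efforts maximize utility over `[0, ∞)`. -/
structure IsEquilibrium (x : ℝ → ℝ) (c β ν k δ y : ℝ) (E : Profile) : Prop where
  effortInLine_nonneg : 0 ≤ E.effortInLine
  effortAgainst_nonneg : 0 ≤ E.effortAgainst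
  steady : IsPositiveSteadyState ν k δ β (x E.effortInLine) (x E.effortAgainst) E.prevalence
  bayes_inLine : IsPosterior y
    (β * E.prevalence.g0o0 + (1 - β) * E.prevalence.g1o0)
    (β * E.prevalence.g1o1)
    E.beliefInLine
  bayes_against : IsPosterior y
    ((1 - β) * E.prevalence.g1o1)
    ((1 - β) * E.prevalence.g0o0 + β * E.prevalence.g1o0)
    E.beliefAgainst
  optimal_inLine : IsMaxOn (utility x c E.beliefInLine) (Ici 0) E.effortInLine
  optimal_against : IsMaxOn (utility x c E.beliefAgainst) (Ici 0) E.effortAgainst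

/-- With belief `p` that one's bias is correct, an opinion in line with the bias is correct with at
least the probability of the opposite opinion (equivalently, `p ≥ 1 / 2`). -/
def BiasOptimal (p : ℝ) : Prop :=
  1 - p ≤ p

end RumorModel

/-! In a positive steady state both groups have the same prevalence of information
(`prevalence_eq`). It cancels in Bayes' rule, so only the share `u` of opinion `0` among the
informed of group `1` matters, and the threshold does not depend on `ν`, `k`, `δ`.

Existence: strict concavity makes optimal effort unique, hence continuous in the doubt about one's
bias. An equilibrium is then a fixed point in `u` of a continuous real function. For a strong prior
and `u ≤ 2 / 3`, the doubt after an opposing message is small, so few such messages are verified;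
this yields a fixed point in `[0, 2 / 3]`.

Every equilibrium: optimal effort is at most `1 / c`, so if verification is never certain its rate
is at most some `H < 1`. Opinion `1` then keeps a fixed fraction of the informed (`le_g1o1`), and a
strong prior outweighs the likelihood ratio. -/

/-- A unique maximizer over a compact set depends continuously on the parameter. -/
theorem continuous_argmax {X : Type*} [TopologicalSpace X] {K : Set ℝ} (hK : IsCompact K)
    {g : X → ℝ → ℝ} (hg : Continuous (Function.uncurry g)) {a : X → ℝ} (haK : ∀ q, a q ∈ K)
    (hmax : ∀ q, IsMaxOn (g q) K (a q))
    (huniq : ∀ q, ∀ α ∈ K, IsMaxOn (g q) K α → α = a q) : Continuous a := by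
  rw [continuous_iff_continuousAt]
  intro q
  -- By compactness it is enough that each cluster point is a maximizer; maximality passes to the
  -- limit along an ultrafilter.
  refine hK.tendsto_nhds_of_unique_mapClusterPt (Eventually.of_forall haK) ?_
  intro α hα hcl
  refine huniq q α hα fun α' hα' => ?_
  obtain ⟨U, hU, hUa⟩ := mapClusterPt_iff_ultrafilter.1 hcl
  have hid : Tendsto (fun p : X => p) U (𝓝 q) := hU
  have h1 : Tendsto (fun p => g p α') U (𝓝 (g q α')) :=
    (hg.tendsto (q, α')).comp (hid.prodMk_nhds tendsto_const_nhds)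
  have h2 : Tendsto (fun p => g p (a p)) U (𝓝 (g q α)) :=
    (hg.tendsto (q, α)).comp (hid.prodMk_nhds hUa)
  exact le_of_tendsto_of_tendsto' h1 h2 fun p => hmax p hα'

/-! ### Optimal effort -/

namespace RumorModel

namespace IsVerificationFunction

variable {x : ℝ → ℝ} {xbar : ℝ}

theorem nonneg (hx : IsVerificationFunction x xbar) {α : ℝ} (hα : 0 ≤ α) : 0 ≤ x α :=
  (hx.mem_Icc α hα).1

theorem le_one (hx : IsVerificationFunction x xbar) {α : ℝ} (hα : 0 ≤ α) : x α ≤ 1 :=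
  (hx.mem_Icc α hα).2.trans hx.xbar_le_one

/-- Two maximizers of the verification benefit net of cost cannot both lie where `xbar` has not
been reached. -/
theorem not_two_maximizers_below (hx : IsVerificationFunction x xbar) {c q b α₁ α₂ : ℝ}
    (hq : 0 < q) (h₁ : 0 ≤ α₁) (h₁₂ : α₁ < α₂) (h₂ : α₂ ≤ b) (hs₁ : x α₁ < xbar) (hs₂ : x α₂ < xbar)
    (hm₁ : IsMaxOn (fun α => q * x α - c * α) (Icc 0 b) α₁)
    (hm₂ : IsMaxOn (fun α => q * x α - c * α) (Icc 0 b) α₂) : False := by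
  have hc := hx.strictConcaveOn.2 (show α₁ ∈ {α | 0 ≤ α ∧ x α < xbar} from ⟨h₁, hs₁⟩)
    (show α₂ ∈ {α | 0 ≤ α ∧ x α < xbar} from ⟨h₁.trans h₁₂.le, hs₂⟩) h₁₂.ne
    (show (0 : ℝ) < 1 / 2 by norm_num) (show (0 : ℝ) < 1 / 2 by norm_num) (by norm_num)
  simp only [smul_eq_mul] at hc
  have hmem : 1 / 2 * α₁ + 1 / 2 * α₂ ∈ Icc 0 b := ⟨by linarith, by linarith⟩
  have e1 := hm₁ hmem
  have e2 := hm₂ hmem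
  simp only [mem_ofPred_eq] at e1 e2
  have := mul_lt_mul_of_pos_left hc hq
  nlinarith

/-- The larger maximizer may sit where `xbar` is first reached, outside the domain of strict
concavity. The midpoint is then a maximizer too, and it lies below `xbar` together with `α₁`. -/
theorem not_two_maximizers (hx : IsVerificationFunction x xbar) {c q b α₁ α₂ : ℝ}
    (hc : 0 < c) (hq : 0 ≤ q) (h₁ : 0 ≤ α₁) (h₁₂ : α₁ < α₂) (h₂ : α₂ ≤ b)
    (hm₁ : IsMaxOn (fun α => q * x α - c * α) (Icc 0 b) α₁)
    (hm₂ : IsMaxOn (fun α => q * x α - c * α) (Icc 0 b) α₂) : False := by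
  have below : ∀ α, α₁ ≤ α → α < α₂ → x α < xbar := by
    intro α hα hα'
    by_contra hcon
    have h0 : 0 ≤ α := h₁.trans hα
    have hm := hm₂ (show α ∈ Icc 0 b from ⟨h0, by linarith⟩)
    have hle := (hx.mem_Icc α₂ (by linarith)).2
    simp only [mem_ofPred_eq] at hm
    nlinarith [mul_le_mul_of_nonneg_left (show x α₂ ≤ x α by linarith) hq,
      mul_lt_mul_of_pos_left hα' hc]
  rcases hq.eq_or_lt with rfl | hq
  · have := hm₂ (show α₁ ∈ Icc 0 b from ⟨h₁, by linarith⟩)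
    simp only [mem_ofPred_eq] at this
    nlinarith
  set m := 1 / 2 * α₁ + 1 / 2 * α₂ with hm
  have hm1 : α₁ < m := by linarith
  have hm2 : m < α₂ := by linarith
  refine hx.not_two_maximizers_below hq h₁ hm1 (by linarith) (below _ le_rfl h₁₂)
    (below _ hm1.le hm2) hm₁ ?_
  -- Concavity reaches the endpoint `α₂` by letting `s` tend to it.
  have hmid : (1 / 2 * x α₁ + 1 / 2 * x α₂) ≤ x m := by
    have key : ∀ s ∈ Ioo α₁ α₂, 1 / 2 * x α₁ + 1 / 2 * x s ≤ x (1 / 2 * α₁ + 1 / 2 * s) := by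
      intro s hs
      have := (hx.strictConcaveOn.2
        (show α₁ ∈ {α | 0 ≤ α ∧ x α < xbar} from ⟨h₁, below _ le_rfl h₁₂⟩)
        (show s ∈ {α | 0 ≤ α ∧ x α < xbar} from ⟨h₁.trans hs.1.le, below _ hs.1.le hs.2⟩) hs.1.ne
        (show (0 : ℝ) < 1 / 2 by norm_num) (show (0 : ℝ) < 1 / 2 by norm_num) (by norm_num)).le
      simpa only [smul_eq_mul] using this
    have hcl : closure (Ioo α₁ α₂) = Icc α₁ α₂ := closure_Ioo h₁₂.ne
    have hcont : ContinuousOn x (Icc α₁ α₂) := hx.continuousOn.mono fun α hα => h₁.trans hα.1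
    refine le_on_closure key ?_ ?_ (show α₂ ∈ closure (Ioo α₁ α₂) by
      rw [hcl]; exact ⟨h₁₂.le, le_rfl⟩)
    · rw [hcl]
      fun_prop
    · rw [hcl]
      refine hcont.comp (by fun_prop) fun s hs => ⟨?_, ?_⟩
      · linarith [hs.1]
      · linarith [hs.1, hs.2]
  intro α hα
  have e1 := hm₁ hα
  have e2 := hm₂ hα
  simp only [mem_ofPred_eq] at e1 e2 ⊢
  have := mul_le_mul_of_nonneg_left hmid hq.le
  rw [hm] at this ⊢
  nlinarith

/-- The optimal effort is a continuous function of the probability `q` that one's bias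
is incorrect. -/
theorem exists_continuous_argmax (hx : IsVerificationFunction x xbar) {c b : ℝ} (hc : 0 < c)
    (hb : 0 ≤ b) : ∃ a : ℝ → ℝ, Continuous a ∧ (∀ q, a q ∈ Icc 0 b) ∧
      ∀ q, 0 ≤ q → IsMaxOn (fun α => q * x α - c * α) (Icc 0 b) (a q) := by
  have hcx : Continuous fun α => x (max α 0) := by
    rw [← continuousOn_univ]
    exact hx.continuousOn.comp (by fun_prop) fun α _ => le_max_right α 0
  -- Truncation at `0` makes the objective jointly continuous on the whole plane.
  set g : ℝ → ℝ → ℝ := fun q α => max q 0 * x (max α 0) - c * α with hg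
  have hgc : Continuous (Function.uncurry g) := by
    have : Continuous fun p : ℝ × ℝ => x (max p.2 0) := hcx.comp continuous_snd
    simp only [hg, Function.uncurry_def]
    exact ((continuous_fst.max continuous_const).mul this).sub (continuous_const.mul continuous_snd)
  have hex : ∀ q, ∃ α ∈ Icc 0 b, IsMaxOn (g q) (Icc 0 b) α := fun q =>
    isCompact_Icc.exists_isMaxOn (nonempty_Icc.2 hb)
      (hgc.comp (Continuous.prodMk_right q)).continuousOn
  have hconv : ∀ q, ∀ α ∈ Icc 0 b, IsMaxOn (g q) (Icc 0 b) α →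
      IsMaxOn (fun α => max q 0 * x α - c * α) (Icc 0 b) α := by
    intro q α hα h α' hα'
    have := h hα'
    simp only [hg, mem_ofPred_eq, max_eq_left hα.1, max_eq_left hα'.1] at this ⊢
    exact this
  choose a haK hmax using hex
  refine ⟨a, continuous_argmax isCompact_Icc hgc haK hmax ?_, haK, ?_⟩
  · intro q α hα hm
    have h1 := hconv q α hα hm
    have h2 := hconv q _ (haK q) (hmax q)
    rcases lt_trichotomy α (a q) with h | h | h
    · exact (hx.not_two_maximizers hc (le_max_right q 0) hα.1 h (haK q).2 h1 h2).elim
    · exact h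
    · exact (hx.not_two_maximizers hc (le_max_right q 0) (haK q).1 h hα.2 h2 h1).elim
  · intro q hq
    have := hconv q _ (haK q) (hmax q)
    rwa [max_eq_left hq] at this

/-- Utility is `q * x α - c * α` up to a constant, and effort beyond `1 / c` costs more than the
largest possible gain. -/
theorem isMaxOn_utility (hx : IsVerificationFunction x xbar) {c q α : ℝ} (hc : 0 < c)
    (hq : q ≤ 1)
    (hm : IsMaxOn (fun α => q * x α - c * α) (Icc 0 (1 / c)) α) :
    IsMaxOn (utility x c (1 - q)) (Ici 0) α := by
  have h0 := hm (show (0 : ℝ) ∈ Icc 0 (1 / c) from ⟨le_rfl, by positivity⟩)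
  simp only [mem_ofPred_eq, hx.map_zero] at h0
  intro α' hα'
  simp only [mem_ofPred_eq, utility]
  rcases le_or_gt α' (1 / c) with h | h
  · have := hm (show α' ∈ Icc 0 (1 / c) from ⟨hα', h⟩)
    simp only [mem_ofPred_eq] at this
    linarith
  · have h1 : 1 < c * α' := by
      rw [div_lt_iff₀ hc] at h
      linarith
    have h2 : q * x α' ≤ 1 :=
      mul_le_one₀ hq (hx.nonneg hα') (hx.le_one hα')
    linarith

end IsVerificationFunction

/-- The cost of an optimal effort is at most the probability that one's bias is incorrect. -/
theorem mul_effort_le {x : ℝ → ℝ} {xbar : ℝ} (hx : IsVerificationFunction x xbar) {c p α : ℝ}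
    (hp : p ≤ 1) (hα : 0 ≤ α) (hm : IsMaxOn (utility x c p) (Ici 0) α) : c * α ≤ 1 - p := by
  have h := hm (show (0 : ℝ) ∈ Ici 0 from self_mem_Ici)
  simp only [mem_ofPred_eq, utility, hx.map_zero] at h
  nlinarith [mul_le_mul_of_nonneg_left (hx.le_one hα) (sub_nonneg.2 hp)]

theorem IsPosterior.biasOptimal {y a a' p : ℝ} (h : IsPosterior y a a' p)
    (hpos : 0 < y * a + (1 - y) * a') (hle : (1 - y) * a' ≤ y * a) : BiasOptimal p := by
  have := h.2
  unfold BiasOptimal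
  by_contra hcon
  nlinarith [mul_lt_mul_of_pos_right (not_le.1 hcon) hpos]

/-! ### Steady states -/

/-- If `a < r`, the first group meets informed people at a rate above its own prevalence and the
second below it. This forces `(1 - a) * A < δ < (1 - r) * A`, contradicting `a < r`. -/
theorem prevalence_le_of_steady {A δ β a r : ℝ} (hA : 0 < A) (hβ1 : β < 1)
    (ha0 : 0 < a) (hr0 : 0 < r) (hr1 : r ≤ 1) (hδ : 0 < δ)
    (ha : (1 - a) * A * (β * a + (1 - β) * r) = a * δ)
    (hr : (1 - r) * A * (β * r + (1 - β) * a) = r * δ) : r ≤ a := by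
  by_contra hcon
  push Not at hcon
  have h1 : a < β * a + (1 - β) * r := by nlinarith
  have h2 : β * r + (1 - β) * a < r := by nlinarith
  have hr1' : 0 < (1 - r) * A := by
    refine mul_pos (lt_of_le_of_ne (by linarith) fun h => ?_) hA
    rw [← h] at hr
    nlinarith [mul_pos hr0 hδ]
  have ha1 : 0 < (1 - a) * A := mul_pos (by linarith) hA
  have h3 : (1 - a) * A * a < a * δ := by rw [← ha]; exact mul_lt_mul_of_pos_left h1 ha1
  have h4 : r * δ < (1 - r) * A * r := by rw [← hr]; exact mul_lt_mul_of_pos_left h2 hr1'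
  have h5 : (1 - a) * A < δ := by nlinarith
  have h6 : δ < (1 - r) * A := by nlinarith
  nlinarith

/-- In a positive steady state information is equally prevalent in both groups. -/
theorem IsPositiveSteadyState.prevalence_eq {ν k δ β l h : ℝ} {ρ : Prevalence}
    (hρ : IsPositiveSteadyState ν k δ β l h ρ) (hA : 0 < ν * k) (hδ : 0 < δ)
    (hβ1 : β < 1) :
    0 < ρ.g0o0 ∧ ρ.g1o0 + ρ.g1o1 = ρ.g0o0 ∧ (1 - ρ.g0o0) * (ν * k) = δ := by
  obtain ⟨a0, b0, d0, a1, r1, s0, s1, s2, hp⟩ := hρ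
  obtain ⟨a, b, d⟩ := ρ
  simp only [motion_g0o0, motion_g1o0, motion_g1o1] at *
  have ha : (1 - a) * (ν * k) * (β * a + (1 - β) * (b + d)) = a * δ := by linarith
  have hr : (1 - (b + d)) * (ν * k) * (β * (b + d) + (1 - β) * a) = (b + d) * δ := by
    linear_combination 2 * s1 + 2 * s2
  set r := b + d with hr_def
  have hr0 : 0 ≤ r := by linarith
  generalize ν * k = A at *
  have hapos : 0 < a := by
    refine lt_of_le_of_ne a0 fun h0 => ?_
    subst h0
    have : A * ((1 - β) * r) = 0 := by linear_combination ha
    have h2 : 0 < A * ((1 - β) * r) := mul_pos hA (mul_pos (by linarith) (by linarith))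
    linarith
  have hrpos : 0 < r := by
    refine lt_of_le_of_ne hr0 fun h0 => ?_
    rw [← h0] at hr
    have : A * ((1 - β) * a) = 0 := by linear_combination hr
    have h2 : 0 < A * ((1 - β) * a) := mul_pos hA (mul_pos (by linarith) (by linarith))
    linarith
  have e : r = a := le_antisymm (prevalence_le_of_steady hA hβ1 hapos hrpos r1 hδ ha hr)
    (prevalence_le_of_steady hA hβ1 hrpos hapos a1 hδ hr ha)
  refine ⟨hapos, e, ?_⟩
  rw [e] at ha
  refine mul_right_cancel₀ hapos.ne' ?_
  linear_combination ha

/-- Only the inflow from unverified messages of group `0` is kept. -/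
theorem IsPositiveSteadyState.le_g1o1 {ν k δ β l h : ℝ} {ρ : Prevalence}
    (hρ : IsPositiveSteadyState ν k δ β l h ρ) (hA : 0 < ν * k) (hδ : 0 < δ) (hβ0 : 0 ≤ β)
    (hβ1 : β < 1) (hl : l ≤ 1) (hh : h ≤ 1) :
    (1 - h) * (1 - β) * ρ.g0o0 ≤ ρ.g1o1 := by
  obtain ⟨ha, hr, hs⟩ := hρ.prevalence_eq hA hδ hβ1
  have h1 := hρ.steady_g1o1
  have h2 : (1 - ρ.g1o0 - ρ.g1o1) * (ν * k) = δ := by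
    rw [← hs, ← hr]; ring
  rw [motion_g1o1, mul_assoc (1 / 2 : ℝ), mul_assoc (1 / 2 : ℝ), h2] at h1
  have h3 : δ * ρ.g1o1 = δ * (β * ((1 - h) * ρ.g1o0 + (1 - l) * ρ.g1o1)
      + (1 - β) * (1 - h) * ρ.g0o0) := by linear_combination -2 * h1
  have h4 := mul_left_cancel₀ hδ.ne' h3
  have h5 : 0 ≤ β * ((1 - h) * ρ.g1o0 + (1 - l) * ρ.g1o1) :=
    mul_nonneg hβ0 (add_nonneg (mul_nonneg (by linarith) hρ.g1o0_nonneg)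
      (mul_nonneg (by linarith) hρ.g1o1_nonneg))
  rw [h4]
  linarith

/-- With a share `u` of the informed members of group `1` holding opinion `0` that reproduces
itself, the steady state in closed form. -/
theorem isPositiveSteadyState_of_share {ν k δ β l h u : ℝ} (hν : 0 < ν) (hk : 0 < k) (hδ : 0 < δ)
    (hmu : 1 < ν / δ * k) (hu0 : 0 ≤ u) (hu1 : u ≤ 1)
    (hu : β * (h * u + l * (1 - u)) + (1 - β) * h = u) :
    IsPositiveSteadyState ν k δ β l h
      ⟨1 - δ / (ν * k), (1 - δ / (ν * k)) * u, (1 - δ / (ν * k)) * (1 - u)⟩ := by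
  have hA : 0 < ν * k := mul_pos hν hk
  have hs : (1 - (1 - δ / (ν * k))) * (ν * k) = δ := by field_simp; ring
  have hspos : 0 < 1 - δ / (ν * k) := by
    rw [sub_pos, div_lt_one hA]
    have : ν / δ * k = ν * k / δ := by ring
    rwa [this, one_lt_div hδ] at hmu
  have hsle : 1 - δ / (ν * k) ≤ 1 := by
    have : 0 < δ / (ν * k) := by positivity
    linarith
  generalize 1 - δ / (ν * k) = s at *
  refine ⟨hspos.le, mul_nonneg hspos.le hu0, mul_nonneg hspos.le (by linarith), hsle,
    ?_, ?_, ?_, ?_, ?_⟩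
  · show s * u + s * (1 - u) ≤ 1
    linarith
  · simp only [motion_g0o0]
    linear_combination 1 / 2 * s * hs
  · simp only [motion_g1o0]
    linear_combination 1 / 2 * s * u * hs + 1 / 2 * (1 - s) * (ν * k) * s * hu
  · simp only [motion_g1o1]
    linear_combination 1 / 2 * s * (1 - u) * hs - 1 / 2 * (1 - s) * (ν * k) * s * hu
  · show 0 < (s + (s * u + s * (1 - u))) / 2
    linarith

/-! ### Existence of an equilibrium -/

/-- Complement of the belief formula of Bayes' rule. -/
noncomputable def doubt (y a a' : ℝ) : ℝ := (1 - y) * a' / (y * a + (1 - y) * a')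

theorem doubt_mem_Icc {y a a' : ℝ} (ha : 0 ≤ y * a) (ha' : 0 ≤ (1 - y) * a') :
    doubt y a a' ∈ Icc 0 1 :=
  ⟨div_nonneg ha' (add_nonneg ha ha'), div_le_one_of_le₀ (by linarith) (add_nonneg ha ha')⟩

/-- The factor `s` will be the common prevalence. When `a' = 0` the doubt is `0`, even if the
denominator vanishes. -/
theorem isPosterior_doubt {y a a' s : ℝ} (ha : 0 ≤ y * a) (ha' : 0 ≤ (1 - y) * a')
    (hz : a' = 0 ∨ 0 < y * a + (1 - y) * a') :
    IsPosterior y (s * a) (s * a') (1 - doubt y a a') := by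
  obtain ⟨h0, h1⟩ := doubt_mem_Icc ha ha'
  refine ⟨⟨by linarith, by linarith⟩, ?_⟩
  have : doubt y a a' * (y * a + (1 - y) * a') = (1 - y) * a' := by
    rcases hz with rfl | hz
    · simp [doubt]
    · exact div_mul_cancel₀ _ hz.ne'
  linear_combination -s * this

/-- Given that beliefs against the bias with doubt at most `q` induce verification rates of at most
`1 / 2`, an equilibrium exists if the prior is strong. -/
theorem exists_equilibrium {x : ℝ → ℝ} {xbar : ℝ} (hx : IsVerificationFunction x xbar)
    {c β q y : ℝ} (hc : 0 < c) (hβ0 : 0 ≤ β) (hβ1 : β < 1) (hq0 : 0 < q) (hq1 : q ≤ 1 / 2)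
    (hq : ∀ α, 0 ≤ α → c * α ≤ q → x α ≤ 1 / 2) (hy : 1 / 2 ≤ y) (hy1 : y ≤ 1)
    (hyq : 1 - y ≤ y * ((1 - β) * q / 3))
    {ν k δ : ℝ} (hν : 0 < ν) (hk : 0 < k) (hδ : 0 < δ) (hmu : 1 < ν / δ * k) :
    ∃ E : Profile, IsEquilibrium x c β ν k δ y E ∧
      BiasOptimal E.beliefInLine ∧ BiasOptimal E.beliefAgainst := by
  obtain ⟨a, hac, haI, ham⟩ := hx.exists_continuous_argmax (b := 1 / c) hc (by positivity)
  have hy0 : 0 < y := by linarith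
  have hβ' : 0 < 1 - β := by linarith
  set I : Set ℝ := Icc 0 (2 / 3) with hI
  set q₁ : ℝ → ℝ := fun u => doubt y (β + (1 - β) * u) (β * (1 - u)) with hq₁
  set q₂ : ℝ → ℝ := fun u => doubt y ((1 - β) * (1 - u)) ((1 - β) + β * u) with hq₂
  have n₁ : ∀ u ∈ I, 0 ≤ y * (β + (1 - β) * u) ∧ 0 ≤ (1 - y) * (β * (1 - u)) := by
    rintro u ⟨hu0, hu1⟩
    exact ⟨mul_nonneg hy0.le (add_nonneg hβ0 (mul_nonneg hβ'.le hu0)),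
      mul_nonneg (by linarith) (mul_nonneg hβ0 (by linarith))⟩
  have z₁ : ∀ u ∈ I, 0 < β → 0 < y * (β + (1 - β) * u) + (1 - y) * (β * (1 - u)) := by
    intro u hu hβ
    have : 0 < y * (β + (1 - β) * u) :=
      mul_pos hy0 (add_pos_of_pos_of_nonneg hβ (mul_nonneg hβ'.le hu.1))
    linarith [(n₁ u hu).2]
  have n₂ : ∀ u ∈ I, 0 < y * ((1 - β) * (1 - u)) ∧ 0 ≤ (1 - y) * ((1 - β) + β * u) := by
    rintro u ⟨hu0, hu1⟩
    exact ⟨mul_pos hy0 (mul_pos hβ' (by linarith)),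
      mul_nonneg (by linarith) (add_nonneg hβ'.le (mul_nonneg hβ0 hu0))⟩
  have m₁ : ∀ u ∈ I, q₁ u ∈ Icc (0 : ℝ) 1 := fun u hu => doubt_mem_Icc (n₁ u hu).1 (n₁ u hu).2
  have m₂ : ∀ u ∈ I, q₂ u ∈ Icc (0 : ℝ) 1 := fun u hu =>
    doubt_mem_Icc (n₂ u hu).1.le (n₂ u hu).2
  have b₁ : ∀ u ∈ I, q₁ u ≤ 1 / 2 := by
    intro u hu
    rcases hβ0.eq_or_lt with hβ | hβ
    · simp [hq₁, doubt, ← hβ]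
    · rw [hq₁]
      simp only [doubt]
      rw [div_le_iff₀ (z₁ u hu hβ)]
      have e1 : (1 - y) * (β * (1 - u)) ≤ y * (β * (1 - u)) :=
        mul_le_mul_of_nonneg_right (by linarith) (mul_nonneg hβ0 (by linarith [hu.2]))
      have e2 : y * (β * (1 - u)) ≤ y * (β + (1 - β) * u) :=
        mul_le_mul_of_nonneg_left (by nlinarith [hu.1]) hy0.le
      linarith
  -- On `I`, `1 - u ≥ 1 / 3`, whence the `3` in `hyq`.
  have b₂ : ∀ u ∈ I, q₂ u ≤ q := by
    intro u hu
    rw [hq₂]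
    simp only [doubt]
    rw [div_le_iff₀ (by linarith [n₂ u hu])]
    have e1 : (1 - y) * ((1 - β) + β * u) ≤ 1 - y :=
      mul_le_of_le_one_right (by linarith) (by nlinarith [hu.2])
    have e2 : y * ((1 - β) * q / 3) ≤ q * (y * ((1 - β) * (1 - u))) := by
      have : 0 ≤ y * (1 - β) * q := by positivity
      nlinarith [hu.2]
    nlinarith [mul_nonneg hq0.le (n₂ u hu).2]
  have c₁ : ContinuousOn q₁ I := by
    -- For `β = 0` the denominator vanishes at `u = 0`, but the doubt is identically `0`.
    rcases hβ0.eq_or_lt with hβ | hβ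
    · have : q₁ = fun _ => 0 := by funext u; simp [hq₁, doubt, ← hβ]
      rw [this]
      exact continuousOn_const
    · exact ContinuousOn.div (by fun_prop) (by fun_prop) fun u hu => (z₁ u hu hβ).ne'
  have c₂ : ContinuousOn q₂ I :=
    ContinuousOn.div (by fun_prop) (by fun_prop) fun u hu => by linarith [n₂ u hu]
  have hxa : Continuous fun q => x (a q) := by
    rw [← continuousOn_univ]
    exact hx.continuousOn.comp hac.continuousOn fun q _ => (haI q).1
  have cl := hxa.comp_continuousOn c₁
  have ch := hxa.comp_continuousOn c₂
  have opt : ∀ p ∈ Icc (0 : ℝ) 1, IsMaxOn (utility x c (1 - p)) (Ici 0) (a p) := fun p hp =>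
    hx.isMaxOn_utility hc hp.2 (ham p hp.1)
  have hhalf : ∀ u ∈ I, x (a (q₂ u)) ≤ 1 / 2 := by
    intro u hu
    refine hq _ (haI _).1 ?_
    have := mul_effort_le hx (by linarith [(m₂ u hu).1]) (haI _).1 (opt _ (m₂ u hu))
    linarith [b₂ u hu]
  -- At `u = 2 / 3`, rates `h ≤ 1 / 2` and `l ≤ 1` give at most `β * (1 / 3 + 1 / 3) + (1 - β) / 2 ≤
  -- 2 / 3`.
  obtain ⟨u, hu, hfix⟩ := exists_mem_Icc_isFixedPt
    (f := fun u => β * (x (a (q₂ u)) * u + x (a (q₁ u)) * (1 - u)) + (1 - β) * x (a (q₂ u)))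
    (a := 0) (b := 2 / 3)
    ((continuousOn_const.mul ((ch.mul continuousOn_id).add
      (cl.mul (continuousOn_const.sub continuousOn_id)))).add (continuousOn_const.mul ch))
    (by norm_num)
    (by
      have hh := hx.nonneg (haI (q₂ 0)).1
      have hl := hx.nonneg (haI (q₁ 0)).1
      simp only [mul_zero, sub_zero, zero_add, mul_one]
      positivity)
    (by
      have h1 := mul_le_mul_of_nonneg_left (hhalf (2 / 3) ⟨by norm_num, le_rfl⟩) hβ0
      have h2 := mul_le_mul_of_nonneg_left (hhalf (2 / 3) ⟨by norm_num, le_rfl⟩) hβ'.le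
      have h3 := mul_le_mul_of_nonneg_left (hx.le_one (haI (q₁ (2 / 3))).1) hβ0
      linarith)
  have hfix' : β * (x (a (q₂ u)) * u + x (a (q₁ u)) * (1 - u)) + (1 - β) * x (a (q₂ u)) = u := hfix
  have hst := isPositiveSteadyState_of_share hν hk hδ hmu hu.1 (by linarith [hu.2]) hfix'
  refine ⟨⟨a (q₁ u), a (q₂ u), _, 1 - q₁ u, 1 - q₂ u⟩,
    ⟨(haI _).1, (haI _).1, hst, ?_, ?_, opt _ (m₁ u hu), opt _ (m₂ u hu)⟩, ?_, ?_⟩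
  · convert isPosterior_doubt (s := 1 - δ / (ν * k)) (n₁ u hu).1 (n₁ u hu).2 ?_ using 1
    · simp only; ring
    · simp only; ring
    · rcases hβ0.eq_or_lt with hβ | hβ
      · simp [← hβ]
      · exact Or.inr (z₁ u hu hβ)
  · convert isPosterior_doubt (s := 1 - δ / (ν * k)) (n₂ u hu).1.le (n₂ u hu).2
      (Or.inr (by linarith [n₂ u hu])) using 1
    · simp only; ring
    · simp only; ring
  · show 1 - (1 - q₁ u) ≤ 1 - q₁ u
    linarith [b₁ u hu]
  · show 1 - (1 - q₂ u) ≤ 1 - q₂ u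
    linarith [b₂ u hu]

/-! ### Beliefs in an arbitrary equilibrium -/

/-- Equal prevalence gives `g1o1 ≤ g0o0`, so the message is at least as likely when the bias is
correct; `β > 0` gives it positive probability. -/
theorem IsEquilibrium.biasOptimal_inLine {x : ℝ → ℝ} {c β ν k δ y : ℝ} {E : Profile}
    (hE : IsEquilibrium x c β ν k δ y E) (hν : 0 < ν) (hk : 0 < k) (hδ : 0 < δ) (hβ0 : 0 < β)
    (hβ1 : β < 1) (hy : 1 / 2 ≤ y) (hy1 : y ≤ 1) : BiasOptimal E.beliefInLine := by
  obtain ⟨ha, hr, -⟩ := hE.steady.prevalence_eq (mul_pos hν hk) hδ hβ1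
  have hb := hE.steady.g1o0_nonneg
  have hd := hE.steady.g1o1_nonneg
  have h1 : 0 < β * E.prevalence.g0o0 + (1 - β) * E.prevalence.g1o0 :=
    add_pos_of_pos_of_nonneg (mul_pos hβ0 ha) (mul_nonneg (by linarith) hb)
  have h2 : β * E.prevalence.g1o1 ≤ β * E.prevalence.g0o0 + (1 - β) * E.prevalence.g1o0 := by
    nlinarith [mul_nonneg (show 0 ≤ 1 - β by linarith) hb]
  have h3 : 0 ≤ β * E.prevalence.g1o1 := mul_nonneg hβ0.le hd
  have h4 := mul_pos (show 0 < y by linarith) h1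
  have h5 := mul_nonneg (show 0 ≤ 1 - y by linarith) h3
  exact hE.bayes_inLine.biasOptimal (by linarith)
    (mul_le_mul (by linarith) h2 h3 (by linarith))

theorem IsEquilibrium.biasOptimal_against {x : ℝ → ℝ} {xbar : ℝ}
    (hx : IsVerificationFunction x xbar) {c β ν k δ y H : ℝ} {E : Profile}
    (hE : IsEquilibrium x c β ν k δ y E) (hc : 0 < c) (hν : 0 < ν) (hk : 0 < k) (hδ : 0 < δ)
    (hβ0 : 0 ≤ β) (hβ1 : β < 1) (hy : 1 / 2 ≤ y) (hy1 : y ≤ 1) (hH1 : H < 1)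
    (hH : ∀ α ∈ Icc 0 (1 / c), x α ≤ H) (hyH : 1 - y ≤ y * ((1 - β) * ((1 - H) * (1 - β)))) :
    BiasOptimal E.beliefAgainst := by
  have hA := mul_pos hν hk
  obtain ⟨ha, hr, -⟩ := hE.steady.prevalence_eq hA hδ hβ1
  have hb := hE.steady.g1o0_nonneg
  have hd := hE.steady.g1o1_nonneg
  have hα0 := hE.effortAgainst_nonneg
  have hcα := mul_effort_le hx hE.bayes_against.1.2 hα0 hE.optimal_against
  have hh : x E.effortAgainst ≤ H := by
    refine hH _ ⟨hα0, ?_⟩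
    rw [le_div_iff₀ hc]
    linarith [hE.bayes_against.1.1]
  have hlow := hE.steady.le_g1o1 hA hδ hβ0 hβ1 (hx.le_one hE.effortInLine_nonneg) (hx.le_one hα0)
  have hβ' : 0 < 1 - β := by linarith
  have h1 : (1 - H) * (1 - β) * E.prevalence.g0o0 ≤ E.prevalence.g1o1 := by
    refine le_trans ?_ hlow
    gcongr
  have hy0 : 0 < y := by linarith
  have h2 : y * ((1 - β) * ((1 - H) * (1 - β) * E.prevalence.g0o0))
      ≤ y * ((1 - β) * E.prevalence.g1o1) := by gcongr
  have h3 : (1 - β) * E.prevalence.g0o0 + β * E.prevalence.g1o0 ≤ E.prevalence.g0o0 := by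
    nlinarith
  have h4 : 0 ≤ (1 - β) * E.prevalence.g0o0 + β * E.prevalence.g1o0 := by positivity
  have h5 := mul_le_mul_of_nonneg_left h3 (show 0 ≤ 1 - y by linarith)
  have h6 := mul_le_mul_of_nonneg_right hyH ha.le
  have h7 := mul_nonneg (show 0 ≤ 1 - y by linarith) h4
  have h8 : 0 < y * ((1 - β) * ((1 - H) * (1 - β) * E.prevalence.g0o0)) :=
    mul_pos hy0 (mul_pos hβ' (mul_pos (mul_pos (by linarith) hβ') ha))
  exact hE.bayes_against.biasOptimal (by linarith) (by linarith)

/-- Small efforts verify at most half of the messages. -/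
theorem IsVerificationFunction.exists_doubt_bound {x : ℝ → ℝ} {xbar : ℝ}
    (hx : IsVerificationFunction x xbar) {c : ℝ} (hc : 0 < c) :
    ∃ q, 0 < q ∧ q ≤ 1 / 2 ∧ ∀ α, 0 ≤ α → c * α ≤ q → x α ≤ 1 / 2 := by
  have h := hx.continuousOn 0 (show (0 : ℝ) ∈ Ici 0 from self_mem_Ici)
  rw [Metric.continuousWithinAt_iff] at h
  obtain ⟨ε, hε, h⟩ := h (1 / 2) (by norm_num)
  refine ⟨min (1 / 2) (c * ε / 2), by positivity, min_le_left _ _, fun α hα hcα => ?_⟩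
  have h1 : c * α ≤ c * ε / 2 := hcα.trans (min_le_right _ _)
  have h2 : α < ε := by nlinarith [mul_pos hc hε]
  have := h hα (by rwa [Real.dist_eq, sub_zero, abs_of_nonneg hα])
  rw [hx.map_zero, Real.dist_eq, sub_zero] at this
  exact (le_abs_self _).trans this.le

/-- If verification is never certain, optimal efforts verify at most a share `H < 1`. -/
theorem IsVerificationFunction.exists_rate_bound {x : ℝ → ℝ} {xbar : ℝ}
    (hx : IsVerificationFunction x xbar) {b : ℝ} (hb : 0 ≤ b) :
    ∃ H < 1, (∀ α : ℝ, 0 ≤ α → x α < 1) → ∀ α ∈ Icc 0 b, x α ≤ H := by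
  by_cases h : ∀ α : ℝ, 0 ≤ α → x α < 1
  · obtain ⟨α, hα, hm⟩ := isCompact_Icc.exists_isMaxOn (nonempty_Icc.2 hb)
      (hx.continuousOn.mono fun α (hα : α ∈ Icc 0 b) => hα.1)
    exact ⟨x α, h α hα.1, fun _ α' hα' => hm hα'⟩
  -- A dummy value: `H` must exist before the threshold is fixed, whether or not verification can be
  -- certain.
  · exact ⟨0, one_pos, fun h' => (h h').elim⟩

end RumorModel

theorem proposition3 (x : ℝ → ℝ) (xbar : ℝ) (hx : RumorModel.IsVerificationFunction x xbar)
    (c : ℝ) (hc : 0 < c) (β : ℝ) (hβ0 : 0 ≤ β) (hβ1 : β < 1) :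
    ∃ ybar : ℝ, 1 / 2 < ybar ∧ ybar < 1 ∧
      ∀ y : ℝ, ybar ≤ y → y ≤ 1 →
        ∀ ν k δ : ℝ, 0 < ν → 0 < k → 0 < δ → 1 < ν / δ * k →
          (∃ E : RumorModel.Profile, RumorModel.IsEquilibrium x c β ν k δ y E ∧
            RumorModel.BiasOptimal E.beliefInLine ∧ RumorModel.BiasOptimal E.beliefAgainst) ∧
          ((∀ α : ℝ, 0 ≤ α → x α < 1) →
            ∀ E : RumorModel.Profile, RumorModel.IsEquilibrium x c β ν k δ y E →
              RumorModel.BiasOptimal E.beliefAgainst ∧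
                (0 < β → RumorModel.BiasOptimal E.beliefInLine)) := by
  obtain ⟨q, hq0, hq1, hq⟩ := hx.exists_doubt_bound hc
  obtain ⟨H, hH1, hH⟩ := hx.exists_rate_bound (b := 1 / c) (by positivity)
  have hβ' : 0 < 1 - β := by linarith
  have hH' : 0 < 1 - H := by linarith
  -- `κ` bounds the prior odds `(1 - y) / y` as both halves require; `y = 1 / (1 + κ)` attains these
  -- odds, and `κ < 1` puts it above `1 / 2`.
  set κ := min ((1 - β) * q / 3) ((1 - β) * ((1 - H) * (1 - β))) with hκ
  have hκ0 : 0 < κ := lt_min (by positivity) (by positivity)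
  have hκ1 : κ < 1 := (min_le_left _ _).trans_lt (by nlinarith)
  refine ⟨1 / (1 + κ), ?_, ?_, ?_⟩
  · rw [div_lt_div_iff₀ (by norm_num) (by linarith)]
    linarith
  · rw [div_lt_one (by linarith)]
    linarith
  · intro y hy hy1 ν k δ hν hk hδ hmu
    have hyκ : 1 - y ≤ y * κ := by
      rw [div_le_iff₀ (by linarith)] at hy
      linarith
    have hy2 : 1 / 2 ≤ y := by nlinarith
    have hy0 : 0 ≤ y := by linarith
    refine ⟨RumorModel.exists_equilibrium hx hc hβ0 hβ1 hq0 hq1 hq hy2 hy1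
      (hyκ.trans (mul_le_mul_of_nonneg_left (min_le_left _ _) hy0)) hν hk hδ hmu,
      fun hlt E hE => ⟨?_, fun hβ => hE.biasOptimal_inLine hν hk hδ hβ hβ1 hy2 hy1⟩⟩
    exact hE.biasOptimal_against hx hc hν hk hδ hβ0 hβ1 hy2 hy1 hH1 (hH hlt)
      (hyκ.trans (mul_le_mul_of_nonneg_left (min_le_right _ _) hy0))
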